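/- For every $r>1$ there is a constant $c_r>0$, depending only on $r$, such that the following holds. Let $d\ge 3$ and $q\in\mathbb N=\{0,1,2,\dots\}$, let $0<\tau_1\le\tau_2\le\cdots$ be a sequence with $\tau_k\ge c\,k^r$ for all $k\ge 1$ and some $c>1$, and set $\rho_k:=2\tau_k+\sqrt{1+4\tau_k^2}$ and $\omega_k:=\log\rho_k$. Let $$\Lambda_{\omega,q,d}:=\Big\{\alpha\in\mathbb N^d:\ \sum_{\ell=1}^d\omega_\ell\alpha_\ell\le q\Big\},\qquad \mathcal P_{\omega,q}:=\operatorname{span}\{x^\alpha:\alpha\in\Lambda_{\omega,q,d}\}\subset C([0,1]^d).$$ Then $\Lambda_{\omega,q,d}$ is finite with $|\Lambda_{\omega,q,d}|\le c_r(\log d)^{q/r}$, and the following error estimate holds with the same constant $c_r$. Let $\Sigma(t):=\{z\in\mathbb C:\operatorname{dist}(z,[0,1])\le t\}$ and $\Sigma(\tau):=\Sigma(\tau_1)\times\cdots\times\Sigma(\tau_d)$, and let the real-valued function $v\in C([0,1]^d)$ admit an analytic extension $\tilde v$ into $\Sigma(\tau)$, that is, $\tilde v:\Sigma(\tau)\to\mathbb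 C$ is continuous, is holomorphic in the interior of $\Sigma(\tau)$, and coincides with $v$ on $[0,1]^d$. Let $\xi_\alpha\in[0,1]^d$, $\alpha\in\Lambda_{\omega,q,d}$, be any nodes that are unisolvent for $\mathcal P_{\omega,q}$ (each vector of nodal values is attained by exactly one $p\in\mathcal P_{\omega,q}$), let $I_{\omega,q}:C([0,1]^d)\to\mathcal P_{\omega,q}$ be the interpolation operator at these nodes, and let $L_{\omega,q}:=\max_{x\in[0,1]^d}\sum_{\alpha}|\ell_\alpha(x)|$ be its Lebesgue constant, where $\ell_\alpha\in\mathcal P_{\omega,q}$ are the Lagrange functions, $\ell_\alpha(\xi_\beta)=\delta_{\alpha\beta}$. Then $$\big\|v-I_{\omega,q}v\big\|_{C([0,1]^d)}\le(1+L_{\omega,q})\,c_r\,2^{d+1}\,e^{-q\left(1-\frac1r\log\log d\right)}\,\|\tilde v\|_{C(\Sigma(\tau))},$$ where both norms are supremum norms. -/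

import Mathlib

noncomputable section

namespace WTD

/-- The unit cube `[0,1]^d`. Functions in `C([0,1]^d)` are elements of `C(Cube d, ℝ)`, which
carries the supremum norm. -/
abbrev Cube (d : ℕ) : Type := Fin d → unitInterval

/-- The region `Σ(τ₁) × ⋯ × Σ(τ_d) ⊆ ℂ^d`, where
`Σ(t) = {z ∈ ℂ : dist(z, [0,1]) ≤ t}`. -/
def region {d : ℕ} (τ : Fin d → ℝ) : Set (Fin d → ℂ) :=
  {z | ∀ k, Metric.infDist (z k) ((fun x : ℝ => (x : ℂ)) '' Set.Icc (0 : ℝ) 1) ≤ τ k}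

/-- `vt` is an analytic extension of `v` into the region `Σ(τ)`: it is continuous on the (closed)
region, holomorphic in its interior, and agrees with `v` on the cube. (A function that is analytic
on a neighbourhood of the closed region has the first two properties.) -/
structure IsAnalyticExtension {d : ℕ} (τ : Fin d → ℝ) (v : C(Cube d, ℝ))
    (vt : (Fin d → ℂ) → ℂ) : Prop where
  continuousOn : ContinuousOn vt (region τ)
  analyticOn_interior : AnalyticOnNhd ℂ vt (interior (region τ))
  extends_cube : ∀ x : Cube d, vt (fun k => (((x k : unitInterval) : ℝ) : ℂ)) = ((v x : ℝ) : ℂ)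

/-- The norm of `C(Σ(τ))`, i.e. the supremum of `|vt|` over the region. -/
def regionNorm {d : ℕ} (τ : Fin d → ℝ) (vt : (Fin d → ℂ) → ℂ) : ℝ :=
  ⨆ z : region τ, ‖vt z‖

/-- `ρ = 2 t + √(1 + 4 t²)`. -/
def rho (t : ℝ) : ℝ := 2 * t + Real.sqrt (1 + 4 * t ^ 2)

/-- The weights `ω_k = log ρ_k`, `k = 1, …, d`, where the sequence `τ₁, τ₂, …` is stored as
`τ 0, τ 1, …`. -/
def weight (τ : ℕ → ℝ) (d : ℕ) : Fin d → ℝ := fun k => Real.log (rho (τ k))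

/-- The weighted total degree index set `Λ_{ω,q,d} = {α ∈ ℕ^d : ∑ ω_ℓ α_ℓ ≤ q}`. -/
def indexSet {d : ℕ} (ω : Fin d → ℝ) (q : ℕ) : Set (Fin d → ℕ) :=
  {α | ∑ l, ω l * (α l : ℝ) ≤ (q : ℝ)}

/-- For positive weights the index set is finite. -/
theorem indexSet_finite {d : ℕ} {ω : Fin d → ℝ} (hω : ∀ l, 0 < ω l) (q : ℕ) :
    (indexSet ω q).Finite := by
  refine (Set.finite_Iic (fun l => ⌊(q : ℝ) / ω l⌋₊)).subset ?_
  intro α hα l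
  refine Nat.le_floor ?_
  rw [le_div_iff₀ (hω l), mul_comm]
  refine le_trans ?_ (show ∑ l, ω l * (α l : ℝ) ≤ (q : ℝ) from hα)
  exact Finset.single_le_sum (f := fun l => ω l * (α l : ℝ))
    (fun i _ => mul_nonneg (hω i).le (Nat.cast_nonneg _)) (Finset.mem_univ l)

/-- The monomial `x^α` as a function on the cube. -/
def monomialFun {d : ℕ} (α : Fin d → ℕ) : C(Cube d, ℝ) where
  toFun x := ∏ k, ((x k : unitInterval) : ℝ) ^ α k
  continuous_toFun := by fun_prop

/-- The weighted total degree polynomial space `P_{ω,q} = span {x^α : α ∈ Λ_{ω,q,d}}`. -/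
def polySpace {d : ℕ} (ω : Fin d → ℝ) (q : ℕ) : Submodule ℝ C(Cube d, ℝ) :=
  Submodule.span ℝ (monomialFun '' indexSet ω q)

section Interpolation

variable {d : ℕ} {ω : Fin d → ℝ} {q : ℕ}

/-- Evaluation of the polynomials in `P_{ω,q}` at nodes `ξ_α ∈ [0,1]^d`, `α ∈ Λ_{ω,q,d}`. -/
def nodeEval (ξ : indexSet ω q → Cube d) : polySpace ω q →ₗ[ℝ] (indexSet ω q → ℝ) where
  toFun p := fun α => (p : C(Cube d, ℝ)) (ξ α)
  map_add' _ _ := rfl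
  map_smul' _ _ := rfl

/-- The nodes are unisolvent for `P_{ω,q}`: all nodal values are attained by exactly one
polynomial in the space, i.e. the Vandermonde matrix is invertible. -/
def Unisolvent (ξ : indexSet ω q → Cube d) : Prop := Function.Bijective (nodeEval ξ)

/-- The polynomial in `P_{ω,q}` with prescribed nodal values. -/
def fromNodalValues {ξ : indexSet ω q → Cube d} (hξ : Unisolvent ξ) :
    (indexSet ω q → ℝ) ≃ₗ[ℝ] polySpace ω q :=
  (LinearEquiv.ofBijective (nodeEval ξ) hξ).symm

/-- The interpolation operator `I_{ω,q} : C([0,1]^d) → P_{ω,q}` at unisolvent nodes: `I v` is the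
unique element of `P_{ω,q}` which agrees with `v` at all nodes. -/
def interp {ξ : indexSet ω q → Cube d} (hξ : Unisolvent ξ) (v : C(Cube d, ℝ)) : polySpace ω q :=
  fromNodalValues hξ (fun α => v (ξ α))

open scoped Classical in
/-- The Lagrange basis function of the node `ξ_α`. -/
def lagrange {ξ : indexSet ω q → Cube d} (hξ : Unisolvent ξ) (α : indexSet ω q) : polySpace ω q :=
  fromNodalValues hξ (Pi.single α 1)

/-- The Lebesgue constant `L_{ω,q} = max_x ∑_α |ℓ_α(x)|` of the interpolation operator (a finite
sum, since the index set is finite for positive weights). -/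
def lebesgueConst {ξ : indexSet ω q → Cube d} (hξ : Unisolvent ξ) : ℝ :=
  ‖∑ᶠ α : indexSet ω q, |(lagrange hξ α : C(Cube d, ℝ))|‖

end Interpolation

end WTD

end

/-! Interpolation reproduces polynomials, so the error is at most `1 + L` times the best
approximation error (`norm_sub_interp_le`), and it suffices to truncate a Chebyshev expansion. Pull
the extension back to the torus by x_k = (1 + cos 2πt_k)/2. Moving the contours to the polyellipses
with parameters ±ω_k, which still lie in Σ(τ), shows that the n-th Fourier coefficient is at most
e^{-∑ω_k|n_k|} times the norm of the extension (`norm_mFourierCoeff_le`). Averaging the Fourier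
series over the reflections t_k ↦ -t_k turns it into a series of products of Chebyshev polynomials,
bounded by 1 on the cube (`hasSum_chebyshev`). Rankin's trick controls both the tail and the
cardinality. For 0 < s ≤ 1 the tail over ∑ω_k|n_k| > q is at most e^{-q(1-s)} K(s), where K(s) = ∑_n
e^{-s∑ω_k|n_k|} is an explicit product; for any s > 0 the cardinality is at most e^{qs} K(s). For s
= (log log d)/r, e^{qs} = (log d)^{q/r}, and the growth of ω_k bounds K(s) independently of d
(`weightProd_le_constBound`). -/

/-! ### Contour shift for an averaged holomorphic family. -/

noncomputable section
namespace WTD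
open MeasureTheory Set

/-- A holomorphic function that does not depend on the imaginary part is constant. Cauchy's theorem
on a rectangle, integrated over `t`, gives this without differentiating under the integral sign. -/
theorem integral_eq_of_vertical_shift_invariant {X : Type*} [TopologicalSpace X] [CompactSpace X]
    [T2Space X] [SecondCountableTopology X] [MeasurableSpace X] [BorelSpace X] (μ : Measure X)
    [IsFiniteMeasure μ] (Φ : ℂ → X → ℂ) {x : ℝ} (hx : 0 ≤ x)
    (hc : ContinuousOn (Function.uncurry Φ) ({z : ℂ | z.re ∈ Icc 0 x} ×ˢ univ))
    (hd : ∀ t, DifferentiableOn ℂ (fun z => Φ z t) {z : ℂ | z.re ∈ Icc 0 x})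
    (hs : ∀ (z : ℂ) (y : ℝ), ∫ t, Φ (z + y * Complex.I) t ∂μ = ∫ t, Φ z t ∂μ) :
    ∫ t, Φ x t ∂μ = ∫ t, Φ 0 t ∂μ := by
  have key : ∀ (γ : ℝ → ℂ), Continuous γ → ∀ a b : ℝ, a ≤ b →
      (∀ s ∈ Icc a b, (γ s).re ∈ Icc 0 x) →
      Integrable (Function.uncurry fun s t => Φ (γ s) t)
        ((volume.restrict (uIoc a b)).prod μ) := by
    intro γ hγ a b hab hre
    have hcont : ContinuousOn (Function.uncurry fun s t => Φ (γ s) t) (Icc a b ×ˢ univ) := by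
      have hm : MapsTo (fun p : ℝ × X => (γ p.1, p.2)) (Icc a b ×ˢ univ)
          ({z : ℂ | z.re ∈ Icc 0 x} ×ˢ univ) := fun p hp => ⟨hre p.1 hp.1, mem_univ _⟩
      exact hc.comp (by fun_prop : Continuous fun p : ℝ × X => (γ p.1, p.2)).continuousOn hm
    have hi : IntegrableOn (Function.uncurry fun s t => Φ (γ s) t) (Icc a b ×ˢ univ)
        (volume.prod μ) := hcont.integrableOn_compact (isCompact_Icc.prod isCompact_univ)
    have hsub : uIoc a b ×ˢ (univ : Set X) ⊆ Icc a b ×ˢ univ := by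
      rw [uIoc_of_le hab]; exact prod_mono Ioc_subset_Icc_self subset_rfl
    have := hi.mono_set hsub
    rwa [IntegrableOn, ← Measure.prod_restrict, Measure.restrict_univ] at this
  have hh : ∀ y : ℝ, ∀ a b : ℝ, a ≤ b → Icc a b ⊆ Icc 0 x →
      Integrable (fun t => ∫ s in a..b, Φ (s + y * Complex.I) t) μ ∧
      ∫ t, (∫ s in a..b, Φ (s + y * Complex.I) t) ∂μ = ∫ s in a..b, ∫ t, Φ s t ∂μ := by
    intro y a b hab hsub
    have hi := key (fun s => s + y * Complex.I) (by fun_prop) a b hab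
      (fun s hs => by simpa using hsub hs)
    constructor
    · simp_rw [intervalIntegral.intervalIntegral_eq_integral_uIoc]
      exact hi.integral_prod_right.smul _
    · rw [← intervalIntegral_integral_swap hi]
      simp_rw [hs]
  have hv : ∀ u ∈ Icc 0 x,
      Integrable (fun t => ∫ y in (0 : ℝ)..1, Φ ((u : ℝ) + y * Complex.I) t) μ ∧
      ∫ t, (∫ y in (0 : ℝ)..1, Φ ((u : ℝ) + y * Complex.I) t) ∂μ = ∫ t, Φ u t ∂μ := by
    intro u hu
    have hi := key (fun y => u + y * Complex.I) (by fun_prop) 0 1 zero_le_one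
      (fun s hs => by simpa using hu)
    constructor
    · simp_rw [intervalIntegral.intervalIntegral_eq_integral_uIoc]
      exact hi.integral_prod_right.smul _
    · rw [← intervalIntegral_integral_swap hi]
      simp_rw [hs]
      simp
  have hrect : ∀ t, (∫ s in (0 : ℝ)..x, Φ (s + (0 : ℝ) * Complex.I) t)
      - (∫ s in (0 : ℝ)..x, Φ (s + (1 : ℝ) * Complex.I) t)
      + Complex.I * (∫ y in (0 : ℝ)..1, Φ (x + y * Complex.I) t)
      - Complex.I * (∫ y in (0 : ℝ)..1, Φ ((0 : ℝ) + y * Complex.I) t) = 0 := by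
    intro t
    have := Complex.integral_boundary_rect_eq_zero_of_differentiableOn (fun z => Φ z t) 0
      (x + Complex.I) ((hd t).mono ?_)
    · simpa using this
    · intro z hz
      simpa [uIcc_of_le hx] using hz.1
  have hx' : x ∈ Icc 0 x := ⟨hx, le_rfl⟩
  have h0' : (0 : ℝ) ∈ Icc 0 x := ⟨le_rfl, hx⟩
  -- After averaging over `t` the two horizontal sides cancel by `hs`, and the vertical sides, of
  -- length 1, leave the two integrals to be compared.
  have hint := integral_congr_ae (μ := μ) (Filter.Eventually.of_forall hrect)
  rw [integral_sub, integral_add, integral_sub, integral_const_mul, integral_const_mul,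
    (hh 0 0 x hx subset_rfl).2, (hh 1 0 x hx subset_rfl).2, (hv x hx').2, (hv 0 h0').2] at hint
  · have h2 : Complex.I * (∫ t, Φ x t ∂μ - ∫ t, Φ 0 t ∂μ) = 0 := by
      simpa [mul_sub] using hint
    exact sub_eq_zero.mp ((mul_eq_zero.mp h2).resolve_left Complex.I_ne_zero)
  · exact (hh 0 0 x hx subset_rfl).1
  · exact (hh 1 0 x hx subset_rfl).1
  · exact (hh 0 0 x hx subset_rfl).1.sub (hh 1 0 x hx subset_rfl).1
  · exact (hv x hx').1.const_mul _
  · exact ((hh 0 0 x hx subset_rfl).1.sub (hh 1 0 x hx subset_rfl).1).add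
      ((hv x hx').1.const_mul _)
  · exact (hv 0 h0').1.const_mul _

end WTD
end

/-! ### Confocal ellipses and the region Σ(τ). -/

noncomputable section
namespace WTD
open MeasureTheory Set

theorem fourier_apply_add {n : ℤ} (x y : UnitAddCircle) :
    fourier n (x + y) = fourier n x * fourier n y := by
  simp [fourier_apply, smul_add, AddCircle.toCircle_add]

theorem fourier_unit_coe (n : ℤ) (x : ℝ) :
    fourier n (x : UnitAddCircle) = Complex.exp (2 * Real.pi * x * n * Complex.I) := by
  rw [fourier_coe_apply]
  congr 1
  push_cast
  ring

/-- The parametrization of confocal ellipses with foci `0` and `1`. -/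
def ellipsePoint (z : ℂ) (u : UnitAddCircle) : ℂ :=
  1 / 2 + (Complex.exp z * fourier 1 u + Complex.exp (-z) * fourier (-1) u) / 4

theorem ellipsePoint_coe (z : ℂ) (x : ℝ) :
    ellipsePoint z x = (1 + Complex.cosh (z + 2 * Real.pi * x * Complex.I)) / 2 := by
  rw [ellipsePoint, fourier_unit_coe, fourier_unit_coe, Complex.cosh, ← Complex.exp_add,
    ← Complex.exp_add]
  push_cast
  ring_nf

theorem ellipsePoint_zero_coe (x : ℝ) :
    ellipsePoint 0 x = (((1 + Real.cos (2 * Real.pi * x)) / 2 : ℝ) : ℂ) := by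
  rw [ellipsePoint_coe, zero_add, Complex.cosh_mul_I]
  push_cast
  ring_nf

/-- With w = a + ib the difference is (cosh a - 1) cos b + i sinh a sin b, and (cosh a - 1)² ≤ sinh²
a. So the ellipse stays close to the segment between its foci. -/
theorem norm_cosh_sub_cos_im_le (w : ℂ) :
    ‖Complex.cosh w - Real.cos w.im‖ ≤ |Real.sinh w.re| := by
  have h : Complex.cosh w - Real.cos w.im
      = ((Real.cosh w.re - 1) * Real.cos w.im : ℝ)
        + (Real.sinh w.re * Real.sin w.im : ℝ) * Complex.I := by
    conv_lhs => rw [← Complex.re_add_im w, Complex.cosh_add, Complex.cosh_mul_I,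
      Complex.sinh_mul_I]
    simp
    ring
  rw [h, Complex.norm_add_mul_I]
  refine Real.sqrt_le_iff.mpr ⟨abs_nonneg _, ?_⟩
  rw [sq_abs]
  have h1 := Real.one_le_cosh w.re
  have h2 := Real.cosh_sq w.re
  have h3 := Real.sin_sq_add_cos_sq w.im
  have h4 : (Real.cosh w.re - 1) ^ 2 ≤ Real.sinh w.re ^ 2 := by nlinarith
  calc _ = (Real.cosh w.re - 1) ^ 2 * Real.cos w.im ^ 2
        + Real.sinh w.re ^ 2 * Real.sin w.im ^ 2 := by ring
    _ ≤ Real.sinh w.re ^ 2 * Real.cos w.im ^ 2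
        + Real.sinh w.re ^ 2 * Real.sin w.im ^ 2 := by gcongr
    _ = _ := by rw [← mul_add, add_comm (Real.cos w.im ^ 2), h3, mul_one]

theorem infDist_ellipsePoint_le (z : ℂ) (u : UnitAddCircle) :
    Metric.infDist (ellipsePoint z u) ((fun x : ℝ => (x : ℂ)) '' Icc (0 : ℝ) 1)
      ≤ |Real.sinh z.re| / 2 := by
  obtain ⟨x, rfl⟩ := QuotientAddGroup.mk_surjective u
  set w : ℂ := z + 2 * Real.pi * x * Complex.I with hw
  have hre : w.re = z.re := by simp [hw]
  have hmem : (((1 + Real.cos w.im) / 2 : ℝ) : ℂ)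
      ∈ (fun x : ℝ => (x : ℂ)) '' Icc (0 : ℝ) 1 := by
    refine ⟨_, ⟨?_, ?_⟩, rfl⟩
    · linarith [Real.neg_one_le_cos w.im]
    · linarith [Real.cos_le_one w.im]
  refine (Metric.infDist_le_dist_of_mem hmem).trans ?_
  rw [ellipsePoint_coe, ← hw, dist_eq_norm, ← hre]
  have : (1 + Complex.cosh w) / 2 - (((1 + Real.cos w.im) / 2 : ℝ) : ℂ)
      = (Complex.cosh w - Real.cos w.im) / 2 := by push_cast; ring
  rw [this, norm_div]
  simpa using div_le_div_of_nonneg_right (norm_cosh_sub_cos_im_le w) (zero_le_two (α := ℝ))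

theorem ellipsePoint_add_mul_I (z : ℂ) (c : ℝ) (u : UnitAddCircle) :
    ellipsePoint (z + c * Complex.I) u
      = ellipsePoint z (u + ((c / (2 * Real.pi) : ℝ) : UnitAddCircle)) := by
  have hpi : (Real.pi : ℂ) ≠ 0 := by exact_mod_cast Real.pi_ne_zero
  rw [ellipsePoint, ellipsePoint, fourier_apply_add, fourier_apply_add, fourier_unit_coe,
    fourier_unit_coe, neg_add, Complex.exp_add, Complex.exp_add]
  have h1 : (2 * Real.pi * (c / (2 * Real.pi) : ℝ) * (1 : ℤ) * Complex.I : ℂ)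
      = c * Complex.I := by push_cast; field_simp
  have h2 : (2 * Real.pi * (c / (2 * Real.pi) : ℝ) * (-1 : ℤ) * Complex.I : ℂ)
      = -(c * Complex.I) := by push_cast; field_simp
  rw [h1, h2]
  ring

theorem region_isClosed {d : ℕ} (τ : Fin d → ℝ) : IsClosed (region τ) := by
  rw [region, ofPred_forall]
  exact isClosed_iInter fun k => isClosed_le
    ((Metric.continuous_infDist_pt _).comp (continuous_apply k)) continuous_const

theorem region_isCompact {d : ℕ} (τ : Fin d → ℝ) : IsCompact (region τ) := by
  refine Metric.isCompact_of_isClosed_isBounded (region_isClosed τ) ?_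
  set S : Set ℂ := (fun x : ℝ => (x : ℂ)) '' Icc (0 : ℝ) 1
  have hS : IsCompact S := isCompact_Icc.image Complex.continuous_ofReal
  have hne : S.Nonempty := ⟨_, mem_image_of_mem _ (left_mem_Icc.mpr zero_le_one)⟩
  refine (Bornology.IsBounded.pi fun k => (hS.isBounded.thickening (δ := τ k + 1))).subset ?_
  intro z hz k _
  exact (Metric.mem_thickening_iff_infDist_lt hne).mpr ((hz k).trans_lt (lt_add_one _))

theorem mem_interior_region {d : ℕ} {τ : Fin d → ℝ} {z : Fin d → ℂ}
    (h : ∀ k, Metric.infDist (z k) ((fun x : ℝ => (x : ℂ)) '' Icc (0 : ℝ) 1) < τ k) :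
    z ∈ interior (region τ) := by
  refine mem_interior.mpr ⟨{z | ∀ k, Metric.infDist (z k)
    ((fun x : ℝ => (x : ℂ)) '' Icc (0 : ℝ) 1) < τ k}, fun z hz k => (hz k).le, ?_, h⟩
  rw [ofPred_forall]
  exact isOpen_iInter_of_finite fun k => isOpen_lt
    ((Metric.continuous_infDist_pt _).comp (continuous_apply k)) continuous_const

theorem le_regionNorm {d : ℕ} {τ : Fin d → ℝ} {v : C(Cube d, ℝ)} {vt : (Fin d → ℂ) → ℂ}
    (h : IsAnalyticExtension τ v vt) {z : Fin d → ℂ} (hz : z ∈ region τ) :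
    ‖vt z‖ ≤ regionNorm τ vt := by
  have hb : BddAbove (range fun z : region τ => ‖vt z‖) := by
    have := ((region_isCompact τ).image_of_continuousOn h.continuousOn.norm).bddAbove
    rwa [image_eq_range] at this
  exact le_ciSup hb (⟨z, hz⟩ : region τ)

theorem regionNorm_nonneg {d : ℕ} (τ : Fin d → ℝ) (vt : (Fin d → ℂ) → ℂ) :
    0 ≤ regionNorm τ vt := Real.iSup_nonneg fun _ => norm_nonneg _

theorem cube_mem_region {d : ℕ} {τ : Fin d → ℝ} (hτ : ∀ k, 0 < τ k) (x : Cube d) :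
    (fun k => (((x k : unitInterval) : ℝ) : ℂ)) ∈ region τ := fun k => by
  have hx : (((x k : unitInterval) : ℝ) : ℂ) ∈ (fun x : ℝ => (x : ℂ)) '' Icc (0 : ℝ) 1 :=
    ⟨_, (x k).2, rfl⟩
  exact (Metric.infDist_zero_of_mem hx).trans_le (hτ k).le

theorem norm_le_regionNorm {d : ℕ} {τ : Fin d → ℝ} (hτ : ∀ k, 0 < τ k) {v : C(Cube d, ℝ)}
    {vt : (Fin d → ℂ) → ℂ} (h : IsAnalyticExtension τ v vt) : ‖v‖ ≤ regionNorm τ vt := by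
  refine (ContinuousMap.norm_le _ (regionNorm_nonneg _ _)).mpr fun x => ?_
  have := le_regionNorm h (cube_mem_region hτ x)
  rwa [h.extends_cube, Complex.norm_real] at this

/-- This explains the form of ρ: the ellipse with parameter ω is within sinh(ω)/2 of [0,1], which
equals τ exactly for ω = arsinh(2τ). -/
theorem weight_eq_arsinh (τ : ℕ → ℝ) (d : ℕ) (k : Fin d) :
    weight τ d k = Real.arsinh (2 * τ k) := by
  rw [weight, rho, Real.arsinh]
  ring_nf

theorem weight_pos {τ : ℕ → ℝ} (hτ : ∀ k, 0 < τ k) (d : ℕ) (k : Fin d) : 0 < weight τ d k := by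
  rw [weight_eq_arsinh]
  exact Real.arsinh_pos_iff.mpr (by linarith [hτ k])

end WTD
end

/-! ### Decay of the Fourier coefficients. -/

noncomputable section
namespace WTD
open MeasureTheory Set

/-- The Haar probability measure on the circle, as in the theory of Fourier coefficients on
`UnitAddTorus`. -/
local instance unitCircleMeasureSpace : MeasureSpace UnitAddCircle := ⟨AddCircle.haarAddCircle⟩

local instance unitCircleIsAddHaarMeasure :
    Measure.IsAddHaarMeasure (volume : Measure UnitAddCircle) :=
  inferInstanceAs (Measure.IsAddHaarMeasure AddCircle.haarAddCircle)

local instance unitCircleIsProbabilityMeasure :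
    IsProbabilityMeasure (volume : Measure UnitAddCircle) :=
  inferInstanceAs (IsProbabilityMeasure AddCircle.haarAddCircle)

variable {d : ℕ}

/-- The integrand of the `n`-th Fourier coefficient of `vt` along a family of polyellipses. -/
def ellipseIntegrand (vt : (Fin d → ℂ) → ℂ) (n : Fin d → ℤ) (η : Fin d → ℝ) (z : ℂ)
    (t : UnitAddTorus (Fin d)) : ℂ :=
  vt (fun k => ellipsePoint (z * η k) (t k)) *
    (Complex.exp (-(z * ∑ k, (n k : ℂ) * η k)) * UnitAddTorus.mFourier (-n) t)

/-- An imaginary shift of `z` only rotates the angles, and the exponential factor absorbs the change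
of the character. Haar invariance then supplies the shift invariance needed for the contour shift,
in all variables at once. -/
theorem ellipseIntegrand_add_mul_I (vt : (Fin d → ℂ) → ℂ) (n : Fin d → ℤ) (η : Fin d → ℝ) (z : ℂ)
    (y : ℝ) (t : UnitAddTorus (Fin d)) :
    ellipseIntegrand vt n η (z + y * Complex.I) t = ellipseIntegrand vt n η z
      (t + fun k => ((y * η k / (2 * Real.pi) : ℝ) : UnitAddCircle)) := by
  have hpi : (Real.pi : ℂ) ≠ 0 := by exact_mod_cast Real.pi_ne_zero
  have h1 : ∀ k, (z + y * Complex.I) * η k = z * η k + ((y * η k : ℝ) : ℂ) * Complex.I := by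
    intro k; push_cast; ring
  have h2 : UnitAddTorus.mFourier (-n)
      (t + fun k => ((y * η k / (2 * Real.pi) : ℝ) : UnitAddCircle))
      = Complex.exp (-(y * Complex.I * ∑ k, (n k : ℂ) * η k)) * UnitAddTorus.mFourier (-n) t := by
    simp only [UnitAddTorus.mFourier, ContinuousMap.coe_mk, Pi.add_apply, Pi.neg_apply,
      fourier_apply_add, Finset.prod_mul_distrib, fourier_unit_coe]
    rw [mul_comm, ← Complex.exp_sum, Finset.mul_sum, ← Finset.sum_neg_distrib]
    congr 2
    refine Finset.sum_congr rfl fun k _ => ?_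
    push_cast
    field_simp
  rw [ellipseIntegrand, ellipseIntegrand, h2]
  simp only [h1, ellipsePoint_add_mul_I, Pi.add_apply]
  rw [add_mul, neg_add, Complex.exp_add]
  ring

theorem ellipsePoint_mem_interior_region {τ : ℕ → ℝ} (hτ : ∀ k, 0 < τ k) {η : Fin d → ℝ}
    (hη : ∀ k, |η k| ≤ weight τ d k) {z : ℂ} (hz : |z.re| < 1) (t : UnitAddTorus (Fin d)) :
    (fun k => ellipsePoint (z * η k) (t k)) ∈ interior (region fun k : Fin d => τ k) := by
  refine mem_interior_region fun k => (infDist_ellipsePoint_le _ _).trans_lt ?_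
  have hω := weight_pos hτ d k
  have hlt : |(z * η k).re| < Real.arsinh (2 * τ k) := by
    rw [← weight_eq_arsinh τ d k]
    rw [Complex.re_mul_ofReal, abs_mul]
    calc _ ≤ |z.re| * weight τ d k := by gcongr; exact hη k
      _ < _ := mul_lt_of_lt_one_left hω hz
  rw [Real.abs_sinh]
  have := Real.sinh_lt_sinh.mpr hlt
  rw [Real.sinh_arsinh] at this
  linarith

theorem continuous_ellipsePoint :
    Continuous fun p : ℂ × UnitAddCircle => ellipsePoint p.1 p.2 := by
  unfold ellipsePoint
  fun_prop

theorem integral_ellipseIntegrand {τ : ℕ → ℝ} (hτ : ∀ k, 0 < τ k) {v : C(Cube d, ℝ)}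
    {vt : (Fin d → ℂ) → ℂ} (h : IsAnalyticExtension (fun k : Fin d => τ k) v vt)
    (n : Fin d → ℤ) {η : Fin d → ℝ} (hη : ∀ k, |η k| ≤ weight τ d k) {x : ℝ} (hx : 0 ≤ x)
    (hx1 : x < 1) :
    ∫ t, ellipseIntegrand vt n η x t = ∫ t, ellipseIntegrand vt n η 0 t := by
  have hlt : ∀ z : ℂ, z.re ∈ Icc 0 x → |z.re| < 1 := fun z hz => by
    rw [abs_of_nonneg hz.1]; exact hz.2.trans_lt hx1
  refine integral_eq_of_vertical_shift_invariant volume (ellipseIntegrand vt n η) hx ?_ ?_ ?_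
  · unfold ellipseIntegrand Function.uncurry
    have hpt : Continuous fun p : ℂ × UnitAddTorus (Fin d) =>
        fun k => ellipsePoint (p.1 * η k) (p.2 k) :=
      continuous_pi fun k => continuous_ellipsePoint.comp
        ((continuous_fst.mul continuous_const).prodMk ((continuous_apply k).comp continuous_snd))
    have hexp : Continuous fun p : ℂ × UnitAddTorus (Fin d) =>
        Complex.exp (-(p.1 * ∑ k, (n k : ℂ) * η k)) * UnitAddTorus.mFourier (-n) p.2 :=
      (Complex.continuous_exp.comp (continuous_fst.mul continuous_const).neg).mul
        ((UnitAddTorus.mFourier (-n)).continuous.comp continuous_snd)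
    exact (h.continuousOn.comp (t := region fun k : Fin d => τ k) hpt.continuousOn fun p hp =>
      interior_subset (ellipsePoint_mem_interior_region hτ hη (hlt p.1 hp.1) p.2)).mul
        hexp.continuousOn
  · intro t
    unfold ellipseIntegrand
    refine DifferentiableOn.mul ?_ (Differentiable.differentiableOn (by fun_prop))
    intro z hz
    refine DifferentiableAt.differentiableWithinAt ?_
    refine DifferentiableAt.comp z (g := vt)
      (f := fun z : ℂ => fun k => ellipsePoint (z * η k) (t k))
      (h.analyticOn_interior _
        (ellipsePoint_mem_interior_region hτ hη (hlt z hz) t)).differentiableAt ?_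
    unfold ellipsePoint
    fun_prop
  · intro z y
    simp_rw [ellipseIntegrand_add_mul_I]
    exact integral_add_right_eq_self (ellipseIntegrand vt n η z) _

theorem norm_mFourierCoeff_le {τ : ℕ → ℝ} (hτ : ∀ k, 0 < τ k) {v : C(Cube d, ℝ)}
    {vt : (Fin d → ℂ) → ℂ} (h : IsAnalyticExtension (fun k : Fin d => τ k) v vt)
    (n : Fin d → ℤ) :
    ‖UnitAddTorus.mFourierCoeff (fun t => vt fun k => ellipsePoint 0 (t k)) n‖
      ≤ Real.exp (-∑ k, weight τ d k * (n k).natAbs) * regionNorm (fun k : Fin d => τ k) vt := by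
  -- The signs make ∑ n_k η_k equal to ∑ ω_k |n_k|, the largest decay available.
  set η : Fin d → ℝ := fun k => SignType.sign (n k) * weight τ d k with hηdef
  have hω : ∀ k, 0 ≤ weight τ d k := fun k => (weight_pos hτ d k).le
  have hη : ∀ k, |η k| ≤ weight τ d k := fun k => by
    rw [hηdef, abs_mul, abs_of_nonneg (hω k)]
    refine mul_le_of_le_one_left (hω k) ?_
    rcases SignType.sign (n k) with _ | _ | _ <;> simp
  have hsum : ∑ k, (n k : ℝ) * η k = ∑ k, weight τ d k * (n k).natAbs := by
    refine Finset.sum_congr rfl fun k _ => ?_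
    have : ((n k).natAbs : ℝ) = (n k : ℝ) * (SignType.sign (n k) : ℝ) := by
      rw [Nat.cast_natAbs, Int.cast_abs]
      rcases lt_trichotomy (n k) 0 with hk | hk | hk
      · simp [sign_neg hk, abs_of_neg (Int.cast_lt_zero (R := ℝ).mpr hk)]
      · simp [hk]
      · simp [sign_pos hk, abs_of_pos (Int.cast_pos (R := ℝ).mpr hk)]
    rw [this, hηdef]; ring
  have h0 : UnitAddTorus.mFourierCoeff (fun t => vt fun k => ellipsePoint 0 (t k)) n
      = ∫ t, ellipseIntegrand vt n η 0 t := by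
    rw [UnitAddTorus.mFourierCoeff]
    refine integral_congr_ae (Filter.Eventually.of_forall fun t => ?_)
    simp [ellipseIntegrand, mul_comm]
  have hb : ∀ x ∈ Ico (0 : ℝ) 1,
      ‖UnitAddTorus.mFourierCoeff (fun t => vt fun k => ellipsePoint 0 (t k)) n‖
      ≤ Real.exp (-(x * ∑ k, weight τ d k * (n k).natAbs))
        * regionNorm (fun k : Fin d => τ k) vt := by
    intro x hx
    rw [h0, ← integral_ellipseIntegrand hτ h n hη hx.1 hx.2]
    refine (norm_integral_le_of_norm_le_const (C := Real.exp (-(x * ∑ k, weight τ d k *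
      (n k).natAbs)) * regionNorm (fun k : Fin d => τ k) vt)
      (Filter.Eventually.of_forall fun t => ?_)).trans_eq (by simp)
    have hx' : |((x : ℂ)).re| < 1 := by
      rw [Complex.ofReal_re, abs_of_nonneg hx.1]; exact hx.2
    rw [ellipseIntegrand, norm_mul, norm_mul, mul_comm]
    refine mul_le_mul ?_ (le_regionNorm h
      (interior_subset (ellipsePoint_mem_interior_region hτ hη hx' t)))
      (norm_nonneg _) (Real.exp_pos _).le
    have he : -((x : ℂ) * ∑ k, (n k : ℂ) * (η k : ℂ))
        = ((-(x * ∑ k, weight τ d k * (n k).natAbs) : ℝ) : ℂ) := by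
      rw [← hsum]; push_cast; rfl
    rw [he, ← Complex.ofReal_exp, Complex.norm_real, Real.norm_of_nonneg (Real.exp_pos _).le]
    refine mul_le_of_le_one_right (Real.exp_pos _).le ?_
    exact ((UnitAddTorus.mFourier (-n)).norm_coe_le_norm t).trans_eq UnitAddTorus.mFourier_norm
  -- At x = 1 the polyellipse may touch the boundary of the region, where holomorphy is not assumed;
  -- hence the bound for x < 1 and the limit.
  have hlim : Filter.Tendsto (fun x : ℝ => Real.exp (-(x * ∑ k, weight τ d k * (n k).natAbs))
        * regionNorm (fun k : Fin d => τ k) vt) (nhdsWithin 1 (Iio 1))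
      (nhds (Real.exp (-(1 * ∑ k, weight τ d k * (n k).natAbs))
        * regionNorm (fun k : Fin d => τ k) vt)) :=
    (Continuous.tendsto (by fun_prop) 1).mono_left nhdsWithin_le_nhds
  rw [one_mul] at hlim
  refine ge_of_tendsto hlim ?_
  filter_upwards [Ico_mem_nhdsLT (zero_lt_one (α := ℝ))] with x hx using hb x hx

end WTD
end

/-! ### Chebyshev expansion, truncation and counting. -/

noncomputable section
namespace WTD
open MeasureTheory Set
variable {d : ℕ}

theorem sum_prod_le_prod {ι : Type*} [DecidableEq ι] (a : Fin d → ι → ℝ) (ha : ∀ k i, 0 ≤ a k i)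
    (A : Fin d → ℝ) (hA : ∀ k (F : Finset ι), ∑ i ∈ F, a k i ≤ A k) (F : Finset (Fin d → ι)) :
    ∑ n ∈ F, ∏ k, a k (n k) ≤ ∏ k, A k := by
  have hsub : F ⊆ Fintype.piFinset fun k => F.image fun n => n k := fun n hn =>
    Fintype.mem_piFinset.mpr fun k => Finset.mem_image_of_mem _ hn
  calc ∑ n ∈ F, ∏ k, a k (n k)
      ≤ ∑ n ∈ Fintype.piFinset fun k => F.image fun n => n k, ∏ k, a k (n k) :=
        Finset.sum_le_sum_of_subset_of_nonneg hsub fun n _ _ =>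
          Finset.prod_nonneg fun k _ => ha k _
    _ = ∏ k, ∑ i ∈ F.image fun n => n k, a k i := (Finset.prod_univ_sum _ _).symm
    _ ≤ _ := Finset.prod_le_prod (fun k _ => Finset.sum_nonneg fun i _ => ha k i)
        fun k _ => hA k _

theorem sum_pow_natAbs_le {y : ℝ} (hy : 0 ≤ y) (hy1 : y < 1) (F : Finset ℤ) :
    ∑ m ∈ F, y ^ m.natAbs ≤ (1 + y) / (1 - y) := by
  have h1 := hasSum_geometric_of_lt_one hy hy1
  have h : HasSum (fun m : ℤ => y ^ m.natAbs) ((1 - y)⁻¹ + y * (1 - y)⁻¹) := by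
    refine HasSum.of_nat_of_neg_add_one (by simpa using h1) ?_
    refine (h1.mul_left y).congr_fun fun n => ?_
    have : (-((n : ℤ) + 1)).natAbs = n + 1 := by omega
    rw [this, pow_succ']
  refine (sum_le_hasSum F (fun m _ => by positivity) h).trans_eq ?_
  field_simp

theorem exp_neg_mul_sum (ω : Fin d → ℝ) (s : ℝ) (m : Fin d → ℕ) :
    Real.exp (-(s * ∑ k, ω k * m k)) = ∏ k, Real.exp (-(s * ω k)) ^ m k := by
  rw [Finset.mul_sum, ← Finset.sum_neg_distrib, Real.exp_sum]
  refine Finset.prod_congr rfl fun k _ => ?_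
  rw [← Real.exp_nat_mul]
  ring_nf

/-- The product `∏ₖ (1 + e^{-s ωₖ}) / (1 - e^{-s ωₖ})`, i.e. the sum of `e^{-s ∑ ωₖ |nₖ|}` over
all `n ∈ ℤ^d`. -/
def weightProd (ω : Fin d → ℝ) (s : ℝ) : ℝ :=
  ∏ k, (1 + Real.exp (-(s * ω k))) / (1 - Real.exp (-(s * ω k)))

theorem sum_exp_neg_le_weightProd {ω : Fin d → ℝ} (hω : ∀ k, 0 < ω k) {s : ℝ} (hs : 0 < s)
    (F : Finset (Fin d → ℤ)) :
    ∑ n ∈ F, Real.exp (-(s * ∑ k, ω k * (n k).natAbs)) ≤ weightProd ω s := by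
  simp_rw [exp_neg_mul_sum ω s fun k => (_ : Fin d → ℤ) k |>.natAbs]
  exact sum_prod_le_prod (fun k (m : ℤ) => Real.exp (-(s * ω k)) ^ m.natAbs)
    (fun k m => by positivity) _ (fun k F => sum_pow_natAbs_le (Real.exp_pos _).le
      (Real.exp_lt_one_iff.mpr (neg_neg_of_pos (mul_pos hs (hω k)))) F) F

/-- The product Chebyshev polynomials on the unit cube. -/
def chebyshevFun (n : Fin d → ℤ) : C(Cube d, ℝ) where
  toFun x := ∏ k, ((Polynomial.Chebyshev.T ℝ (n k)).comp
    (2 * Polynomial.X - 1)).eval ((x k : unitInterval) : ℝ)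
  continuous_toFun := by fun_prop

/-- Only monomials with exponents at most |n_k| occur, and the index set is downward closed since
the weights are nonnegative. -/
theorem chebyshevFun_mem_polySpace {ω : Fin d → ℝ} (hω : ∀ k, 0 ≤ ω k) {q : ℕ} {n : Fin d → ℤ}
    (hn : (fun k => (n k).natAbs) ∈ indexSet ω q) : chebyshevFun n ∈ polySpace ω q := by
  set P : Fin d → Polynomial ℝ := fun k =>
    (Polynomial.Chebyshev.T ℝ (n k)).comp (2 * Polynomial.X - 1)
  have hdeg : ∀ k, (P k).natDegree < (n k).natAbs + 1 := fun k => by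
    refine Nat.lt_succ_of_le (Polynomial.natDegree_comp_le.trans ?_)
    rw [Polynomial.Chebyshev.natDegree_T]
    refine mul_le_of_le_one_right (Nat.zero_le _) ?_
    compute_degree
  have hexp : chebyshevFun n = ∑ β ∈ Fintype.piFinset fun k => Finset.range ((n k).natAbs + 1),
      (∏ k, (P k).coeff (β k)) • monomialFun β := by
    ext x
    rw [ContinuousMap.sum_apply]
    simp only [ContinuousMap.smul_apply, smul_eq_mul, monomialFun, ContinuousMap.coe_mk,
      ← Finset.prod_mul_distrib]
    rw [← Finset.prod_univ_sum (fun k => Finset.range ((n k).natAbs + 1))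
      fun k j => (P k).coeff j * ((x k : unitInterval) : ℝ) ^ j]
    change ∏ k, (P k).eval ((x k : unitInterval) : ℝ) = _
    exact Finset.prod_congr rfl fun k _ => Polynomial.eval_eq_sum_range' (hdeg k) _
  rw [hexp]
  refine Submodule.sum_mem _ fun β hβ => Submodule.smul_mem _ _ (Submodule.subset_span ⟨β, ?_, rfl⟩)
  refine (Finset.sum_le_sum fun k _ => mul_le_mul_of_nonneg_left ?_ (hω k)).trans hn
  have := Finset.mem_range.mp (Fintype.mem_piFinset.mp hβ k)
  exact_mod_cast Nat.lt_succ_iff.mp this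

theorem exists_cube_angle (x : Cube d) :
    ∃ θ : Fin d → ℝ, ∀ k, ((x k : unitInterval) : ℝ) = (1 + Real.cos (2 * Real.pi * θ k)) / 2 := by
  refine ⟨fun k => Real.arccos (2 * (x k : ℝ) - 1) / (2 * Real.pi), fun k => ?_⟩
  have h := (x k).2
  rw [mul_div_cancel₀ _ (by positivity), Real.cos_arccos (by linarith [h.1]) (by linarith [h.2])]
  ring

theorem chebyshevFun_apply (n : Fin d → ℤ) {x : Cube d} {θ : Fin d → ℝ}
    (h : ∀ k, ((x k : unitInterval) : ℝ) = (1 + Real.cos (2 * Real.pi * θ k)) / 2) :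
    chebyshevFun n x = ∏ k, Real.cos (n k * (2 * Real.pi * θ k)) := by
  rw [chebyshevFun, ContinuousMap.coe_mk]
  refine Finset.prod_congr rfl fun k _ => ?_
  rw [Polynomial.eval_comp, h k, ← Polynomial.Chebyshev.T_real_cos]
  congr 1
  simp
  ring

theorem abs_chebyshevFun_le (n : Fin d → ℤ) (x : Cube d) : |chebyshevFun n x| ≤ 1 := by
  obtain ⟨θ, hθ⟩ := exists_cube_angle x
  rw [chebyshevFun_apply n hθ, Finset.abs_prod]
  exact Finset.prod_le_one (fun k _ => abs_nonneg _) fun k _ => Real.abs_cos_le_one _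

theorem sum_sign_mFourier (n : Fin d → ℤ) (θ : Fin d → ℝ) :
    ∑ σ : Fin d → Bool, UnitAddTorus.mFourier n
      (fun k => ((if σ k then θ k else -θ k : ℝ) : UnitAddCircle))
      = 2 ^ d * ((∏ k, Real.cos (n k * (2 * Real.pi * θ k)) : ℝ) : ℂ) := by
  have h := (Finset.prod_univ_sum (fun _ : Fin d => (Finset.univ : Finset Bool))
    fun k b => fourier (n k) ((if b then θ k else -θ k : ℝ) : UnitAddCircle)).symm
  rw [Fintype.piFinset_univ] at h
  simp only [UnitAddTorus.mFourier, ContinuousMap.coe_mk]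
  rw [h]
  have h2 : (2 : ℂ) ^ d = ∏ _k : Fin d, (2 : ℂ) := by simp
  rw [h2, Complex.ofReal_prod, ← Finset.prod_mul_distrib]
  refine Finset.prod_congr rfl fun k _ => ?_
  rw [Fintype.sum_bool, fourier_unit_coe, fourier_unit_coe, Complex.ofReal_cos, Complex.two_cos]
  push_cast
  simp
  ring_nf

/-- All 2^d reflected angle vectors represent the same `x`, so averaging the Fourier series over
them keeps the value and replaces characters by cosines. Real parts suffice because `v` is real.
Indices differing by signs repeat the same polynomial. -/
theorem hasSum_chebyshev {τ : ℕ → ℝ} (hτ : ∀ k, 0 < τ k) {v : C(Cube d, ℝ)}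
    {vt : (Fin d → ℂ) → ℂ} (h : IsAnalyticExtension (fun k : Fin d => τ k) v vt) (x : Cube d) :
    HasSum (fun n : Fin d → ℤ =>
      (UnitAddTorus.mFourierCoeff (fun t => vt fun k => ellipsePoint 0 (t k)) n).re
        * chebyshevFun n x) (v x) := by
  have hω := weight_pos hτ d
  have hmem : ∀ t : UnitAddTorus (Fin d),
      (fun k => ellipsePoint 0 (t k)) ∈ region fun k : Fin d => τ k := fun t => by
    have := interior_subset (ellipsePoint_mem_interior_region hτ (η := fun _ : Fin d => 0)
      (fun k => by simpa using (hω k).le) (z := 0) (by simp) t)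
    simpa using this
  let f : C(UnitAddTorus (Fin d), ℂ) := ⟨fun t => vt fun k => ellipsePoint 0 (t k),
    h.continuousOn.comp_continuous (continuous_pi fun k => continuous_ellipsePoint.comp
      (continuous_const.prodMk (continuous_apply k))) hmem⟩
  set c : (Fin d → ℤ) → ℂ := UnitAddTorus.mFourierCoeff fun t => vt fun k => ellipsePoint 0 (t k)
  have hsum : Summable (UnitAddTorus.mFourierCoeff f) := by
    have hs : Summable fun n : Fin d → ℤ => Real.exp (-∑ k, weight τ d k * (n k).natAbs) :=
      summable_of_sum_le (fun n => (Real.exp_pos _).le) fun F => by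
        simpa only [one_mul] using sum_exp_neg_le_weightProd hω one_pos F
    exact Summable.of_norm_bounded (hs.mul_right _) fun n => norm_mFourierCoeff_le hτ h n
  obtain ⟨θ, hθ⟩ := exists_cube_angle x
  have hpt : ∀ σ : Fin d → Bool,
      f (fun k => ((if σ k then θ k else -θ k : ℝ) : UnitAddCircle)) = v x := fun σ => by
    rw [← h.extends_cube x]
    change vt _ = vt _
    congr 1
    funext k
    rw [ellipsePoint_zero_coe, hθ k]
    cases σ k <;> simp
  have h1 := hasSum_sum (s := Finset.univ) fun σ _ =>
    UnitAddTorus.hasSum_mFourier_series_apply_of_summable hsum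
      (fun k => ((if (σ : Fin d → Bool) k then θ k else -θ k : ℝ) : UnitAddCircle))
  simp only [hpt, ← Finset.smul_sum, sum_sign_mFourier, ← chebyshevFun_apply _ hθ] at h1
  have h2 := (h1.mul_left (((2 : ℂ) ^ d)⁻¹)).mapL Complex.reCLM
  have h3 : (((2 : ℂ) ^ d)⁻¹ * ∑ _σ : Fin d → Bool, ((v x : ℝ) : ℂ)) = ((v x : ℝ) : ℂ) := by
    simp
  rw [h3] at h2
  refine h2.congr_fun fun n => ?_
  change _ = (((2 : ℂ) ^ d)⁻¹ * (c n * (2 ^ d * ((chebyshevFun n x : ℝ) : ℂ)))).re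
  rw [show ((2 : ℂ) ^ d)⁻¹ * (c n * (2 ^ d * ((chebyshevFun n x : ℝ) : ℂ)))
    = c n * ((chebyshevFun n x : ℝ) : ℂ) by field_simp, Complex.re_mul_ofReal]

theorem exists_polySpace_approx {τ : ℕ → ℝ} (hτ : ∀ k, 0 < τ k) {v : C(Cube d, ℝ)}
    {vt : (Fin d → ℂ) → ℂ} (h : IsAnalyticExtension (fun k : Fin d => τ k) v vt) (q : ℕ) {s : ℝ}
    (hs : 0 < s) (hs1 : s ≤ 1) :
    ∃ p ∈ polySpace (weight τ d) q, ‖v - p‖ ≤ Real.exp (-(q : ℝ) * (1 - s))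
      * weightProd (weight τ d) s * regionNorm (fun k : Fin d => τ k) vt := by
  set ω := weight τ d
  set M := regionNorm (fun k : Fin d => τ k) vt
  have hM : 0 ≤ M := regionNorm_nonneg _ _
  have hω : ∀ k, 0 < ω k := weight_pos hτ d
  set c : (Fin d → ℤ) → ℂ := UnitAddTorus.mFourierCoeff fun t => vt fun k => ellipsePoint 0 (t k)
  have hfin : {n : Fin d → ℤ | (fun k => (n k).natAbs) ∈ indexSet ω q}.Finite := by
    refine (indexSet_finite hω q).preimage' (f := fun n : Fin d → ℤ => fun k => (n k).natAbs)
      fun b _ => (Set.finite_Icc (fun k => -(b k : ℤ)) fun k => (b k : ℤ)).subset ?_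
    rintro n rfl
    exact ⟨fun k => by dsimp only; omega, fun k => by dsimp only; omega⟩
  set S := hfin.toFinset
  have hK : 0 ≤ weightProd ω s := by simpa using sum_exp_neg_le_weightProd hω hs ∅
  refine ⟨∑ n ∈ S, (c n).re • chebyshevFun n, Submodule.sum_mem _ fun n hn =>
    Submodule.smul_mem _ _ (chebyshevFun_mem_polySpace (fun k => (hω k).le)
      (hfin.mem_toFinset.mp hn)), ?_⟩
  refine (ContinuousMap.norm_le _ (by positivity)).mpr fun x => ?_
  rw [ContinuousMap.sub_apply, ContinuousMap.sum_apply]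
  simp only [ContinuousMap.smul_apply, smul_eq_mul]
  have hlim : Filter.Tendsto (fun F : Finset (Fin d → ℤ) =>
      ‖∑ n ∈ F, (c n).re * chebyshevFun n x - ∑ n ∈ S, (c n).re * chebyshevFun n x‖)
      Filter.atTop (nhds ‖v x - ∑ n ∈ S, (c n).re * chebyshevFun n x‖) :=
    ((hasSum_chebyshev hτ h x).sub_const _).norm
  refine le_of_tendsto hlim ?_
  filter_upwards [Filter.eventually_ge_atTop S] with F hF
  rw [← Finset.sum_sdiff hF, add_sub_cancel_right]
  calc ‖∑ n ∈ F \ S, (c n).re * chebyshevFun n x‖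
      ≤ ∑ n ∈ F \ S, Real.exp (-(q : ℝ) * (1 - s))
          * Real.exp (-(s * ∑ k, ω k * (n k).natAbs)) * M := by
        refine norm_sum_le_of_le _ fun n hn => ?_
        have hn' : (q : ℝ) ≤ ∑ k, ω k * (n k).natAbs := by
          have := mt hfin.mem_toFinset.mpr (Finset.mem_sdiff.mp hn).2
          exact (not_le.mp this).le
        calc ‖(c n).re * chebyshevFun n x‖ ≤ ‖c n‖ := by
              rw [norm_mul, Real.norm_eq_abs, Real.norm_eq_abs]
              exact (mul_le_of_le_one_right (abs_nonneg _) (abs_chebyshevFun_le n x)).trans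
                (Complex.abs_re_le_norm _)
          _ ≤ Real.exp (-∑ k, ω k * (n k).natAbs) * M := norm_mFourierCoeff_le hτ h n
          -- Split e^{-σ} = e^{-(1-s)σ} e^{-sσ} for the weighted degree σ, and use σ ≥ q with s ≤ 1
          -- in the first factor.
          _ ≤ _ := by
              rw [← Real.exp_add]
              gcongr
              nlinarith
    _ = Real.exp (-(q : ℝ) * (1 - s))
        * (∑ n ∈ F \ S, Real.exp (-(s * ∑ k, ω k * (n k).natAbs))) * M := by
        rw [← Finset.sum_mul, ← Finset.mul_sum]
    _ ≤ _ := by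
        gcongr
        exact sum_exp_neg_le_weightProd hω hs _

/-- Rankin's trick: each index contributes 1 ≤ e^{s(q - ∑ω_k α_k)}; then sum over all of ℤ^d. -/
theorem ncard_indexSet_le {ω : Fin d → ℝ} (hω : ∀ k, 0 < ω k) (q : ℕ) {s : ℝ} (hs : 0 < s) :
    ((indexSet ω q).ncard : ℝ) ≤ weightProd ω s * Real.exp (q * s) := by
  have hfin := indexSet_finite hω q
  rw [ncard_eq_toFinset_card _ hfin]
  set F : Finset (Fin d → ℤ) := hfin.toFinset.map ⟨fun α k => (α k : ℤ), fun α β hαβ => by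
    funext k; exact Int.ofNat_inj.mp (congrFun hαβ k)⟩
  calc ((hfin.toFinset.card : ℕ) : ℝ) = ∑ α ∈ hfin.toFinset, (1 : ℝ) := by simp
    _ ≤ ∑ α ∈ hfin.toFinset, Real.exp (-(s * ∑ k, ω k * α k)) * Real.exp (q * s) := by
        refine Finset.sum_le_sum fun α hα => ?_
        rw [← Real.exp_add]
        refine Real.one_le_exp ?_
        have : ∑ k, ω k * (α k : ℝ) ≤ q := hfin.mem_toFinset.mp hα
        nlinarith
    _ = (∑ n ∈ F, Real.exp (-(s * ∑ k, ω k * (n k).natAbs))) * Real.exp (q * s) := by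
        rw [Finset.sum_map, Finset.sum_mul]
        rfl
    _ ≤ _ := by
        gcongr
        exact sum_exp_neg_le_weightProd hω hs _

end WTD
end

/-! ### Lebesgue's lemma and the dimension-free bound. -/

noncomputable section
namespace WTD
open Set
variable {d : ℕ} {ω : Fin d → ℝ} {q : ℕ}

theorem interp_of_mem {ξ : indexSet ω q → Cube d} (hξ : Unisolvent ξ) (p : polySpace ω q) :
    interp hξ (p : C(Cube d, ℝ)) = p :=
  (LinearEquiv.ofBijective (nodeEval ξ) hξ).symm_apply_apply p

theorem interp_sub {ξ : indexSet ω q → Cube d} (hξ : Unisolvent ξ) (v w : C(Cube d, ℝ)) :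
    interp hξ (v - w) = interp hξ v - interp hξ w := by
  rw [interp, interp, interp, ← map_sub]
  rfl

theorem interp_eq_sum [Fintype (indexSet ω q)] {ξ : indexSet ω q → Cube d} (hξ : Unisolvent ξ)
    (v : C(Cube d, ℝ)) : interp hξ v = ∑ α, v (ξ α) • lagrange hξ α := by
  classical
  simp only [interp, lagrange, ← map_smul, ← map_sum]
  congr 1
  funext β
  simp [Finset.sum_apply, Pi.single_apply]

theorem norm_interp_le (hω : ∀ k, 0 < ω k) {ξ : indexSet ω q → Cube d} (hξ : Unisolvent ξ)
    (v : C(Cube d, ℝ)) : ‖(interp hξ v : C(Cube d, ℝ))‖ ≤ lebesgueConst hξ * ‖v‖ := by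
  have := (indexSet_finite hω q).fintype
  refine (ContinuousMap.norm_le _ (mul_nonneg (norm_nonneg _) (norm_nonneg _))).mpr fun x => ?_
  have hL : ∑ α, |(lagrange hξ α : C(Cube d, ℝ)) x| ≤ lebesgueConst hξ := by
    rw [lebesgueConst, finsum_eq_sum_of_fintype]
    refine le_trans (le_of_eq ?_) ((le_abs_self _).trans
      ((∑ α, |(lagrange hξ α : C(Cube d, ℝ))|).norm_coe_le_norm x))
    rw [ContinuousMap.sum_apply]
    rfl
  rw [interp_eq_sum, Submodule.coe_sum, ContinuousMap.sum_apply]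
  calc _ ≤ ∑ α, |(lagrange hξ α : C(Cube d, ℝ)) x| * ‖v‖ := by
        refine norm_sum_le_of_le _ fun α _ => ?_
        rw [Submodule.coe_smul, ContinuousMap.smul_apply, norm_smul, mul_comm]
        exact mul_le_mul_of_nonneg_left (ContinuousMap.norm_coe_le_norm _ _) (abs_nonneg _)
    _ ≤ _ := by
        rw [← Finset.sum_mul]
        exact mul_le_mul_of_nonneg_right hL (norm_nonneg _)

theorem norm_sub_interp_le (hω : ∀ k, 0 < ω k) {ξ : indexSet ω q → Cube d} (hξ : Unisolvent ξ)
    (v : C(Cube d, ℝ)) {p : C(Cube d, ℝ)} (hp : p ∈ polySpace ω q) :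
    ‖v - (interp hξ v : C(Cube d, ℝ))‖ ≤ (1 + lebesgueConst hξ) * ‖v - p‖ := by
  have h : v - (interp hξ v : C(Cube d, ℝ))
      = (v - p) - (interp hξ (v - p) : C(Cube d, ℝ)) := by
    rw [interp_sub, interp_of_mem hξ ⟨p, hp⟩]
    simp
  rw [h, one_add_mul]
  exact (norm_sub_le _ _).trans (add_le_add_right (norm_interp_le hω hξ _) _)

/-- A bound, depending only on `r`, for the products `weightProd (weight τ d) (log (log d) / r)`
with `d ≥ 3`. -/
def constBound (r : ℝ) : ℝ :=
  Real.exp (2 / (1 - Real.exp (-(Real.log (Real.log 3) / r))) *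
    (Real.exp (Real.exp 2) + ∑' k : ℕ, ((k : ℝ) + 1) ^ (-2 : ℝ)))

theorem one_add_div_one_sub_le {y y₀ : ℝ} (hy : 0 ≤ y) (hy₀ : y ≤ y₀) (h₀ : y₀ < 1) :
    (1 + y) / (1 - y) ≤ Real.exp (2 / (1 - y₀) * y) := by
  have h1 : 0 < 1 - y := by linarith
  have h2 : (1 + y) / (1 - y) = 2 / (1 - y) * y + 1 := by field_simp; ring
  rw [h2]
  refine le_trans ?_ (Real.add_one_le_exp _)
  gcongr

theorem log_log_three_pos : 0 < Real.log (Real.log 3) := by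
  refine Real.log_pos ((Real.lt_log_iff_exp_lt (by norm_num)).mpr ?_)
  linarith [Real.exp_one_lt_d9]

theorem log_log_three_le {d : ℕ} (hd : 2 < d) :
    Real.log (Real.log 3) ≤ Real.log (Real.log d) := by
  have h3 : (3 : ℝ) ≤ d := by exact_mod_cast hd
  have := Real.log_pos (show (1 : ℝ) < 3 by norm_num)
  gcongr

/-- Here ρ ≥ 4τ and 4 > e. The additive 1 matters: it keeps the factor for k = 0 away from its pole.
-/
theorem weight_lower {r : ℝ} (c : ℝ) (hc : 1 < c) {τ : ℕ → ℝ}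
    (hτ : ∀ k : ℕ, c * ((k : ℝ) + 1) ^ r ≤ τ k) (d : ℕ) (k : Fin d) :
    1 + r * Real.log ((k : ℝ) + 1) ≤ weight τ d k := by
  have hk : (0 : ℝ) < ((k : ℕ) : ℝ) + 1 := by positivity
  have hkr : 0 < (((k : ℕ) : ℝ) + 1) ^ r := Real.rpow_pos_of_pos hk r
  have h := hτ k
  have hlow : Real.exp 1 * (((k : ℕ) : ℝ) + 1) ^ r ≤ rho (τ k) := by
    rw [rho]
    have ht : (((k : ℕ) : ℝ) + 1) ^ r ≤ τ k := by nlinarith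
    have hs : 2 * τ k ≤ Real.sqrt (1 + 4 * τ k ^ 2) := Real.le_sqrt_of_sq_le (by nlinarith)
    have := Real.exp_one_lt_d9
    nlinarith
  have := Real.log_le_log (by positivity) hlow
  rwa [Real.log_mul (by positivity) hkr.ne', Real.log_exp, Real.log_rpow hk] at this

theorem weightProd_le_constBound {r : ℝ} (hr : 1 < r) (c : ℝ) (hc : 1 < c) {τ : ℕ → ℝ}
    (hτ : ∀ k : ℕ, c * ((k : ℝ) + 1) ^ r ≤ τ k) {d : ℕ} (hd : 2 < d) :
    weightProd (weight τ d) (1 / r * Real.log (Real.log d)) ≤ constBound r := by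
  set L := Real.log (Real.log d) with hL
  have hr0 : 0 < r := by linarith
  have hL0 : 0 < L := log_log_three_pos.trans_le (log_log_three_le hd)
  set y₀ := Real.exp (-(Real.log (Real.log 3) / r)) with hy₀
  have hy₀1 : y₀ < 1 := Real.exp_lt_one_iff.mpr (neg_neg_of_pos (div_pos log_log_three_pos hr0))
  have hsummable : Summable fun k : ℕ => ((k : ℝ) + 1) ^ (-2 : ℝ) := by
    have := (summable_nat_add_iff 1).mpr (Real.summable_nat_rpow.mpr (by norm_num : (-2 : ℝ) < -1))
    simpa using this
  have hT : 0 ≤ ∑' k : ℕ, ((k : ℝ) + 1) ^ (-2 : ℝ) := tsum_nonneg fun k => by positivity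
  have hy : ∀ k : Fin d, Real.exp (-(1 / r * L * weight τ d k)) ≤
      Real.exp (-(L / r)) * ((k : ℝ) + 1) ^ (-L) := fun k => by
    rw [Real.rpow_def_of_pos (by positivity), ← Real.exp_add]
    refine Real.exp_le_exp.mpr ?_
    have hw := mul_le_mul_of_nonneg_left (weight_lower c hc hτ d k)
      (show 0 ≤ 1 / r * L by positivity)
    have : 1 / r * L * (1 + r * Real.log ((k : ℝ) + 1))
      = L / r + L * Real.log ((k : ℝ) + 1) := by field_simp
    linarith
  have hone : ∀ k : Fin d, ((k : ℝ) + 1) ^ (-L) ≤ 1 := fun k =>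
    Real.rpow_le_one_of_one_le_of_nonpos (by linarith [(k : ℕ).cast_nonneg (α := ℝ)])
      (by linarith)
  have hyL : ∀ k : Fin d, Real.exp (-(1 / r * L * weight τ d k)) ≤ ((k : ℝ) + 1) ^ (-L) :=
    fun k => (hy k).trans (mul_le_of_le_one_left (by positivity)
      (Real.exp_le_one_iff.mpr (neg_nonpos.mpr (by positivity))))
  -- The uniform bound y₀ < 1, needed to linearize each factor, comes from log log d ≥ log log 3 >
  -- 0.
  have hyy : ∀ k : Fin d, Real.exp (-(1 / r * L * weight τ d k)) ≤ y₀ := fun k => by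
    refine (hy k).trans ((mul_le_of_le_one_right (Real.exp_pos _).le (hone k)).trans ?_)
    have := log_log_three_le hd
    rw [hy₀]
    gcongr
  calc weightProd (weight τ d) (1 / r * L)
      ≤ ∏ k : Fin d, Real.exp (2 / (1 - y₀) * Real.exp (-(1 / r * L * weight τ d k))) := by
        refine Finset.prod_le_prod (fun k _ => ?_) fun k _ =>
          one_add_div_one_sub_le (Real.exp_pos _).le (hyy k) hy₀1
        exact div_nonneg (by positivity) (by linarith [hyy k])
    _ = Real.exp (2 / (1 - y₀) * ∑ k : Fin d, Real.exp (-(1 / r * L * weight τ d k))) := by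
        rw [← Real.exp_sum, Finset.mul_sum]
    _ ≤ constBound r := by
        refine Real.exp_le_exp.mpr (mul_le_mul_of_nonneg_left ?_
          (div_nonneg zero_le_two (by linarith)))
        -- For L ≥ 2 the sum is dominated by the convergent ∑ (k+1)^{-2}; for L ≤ 2 the dimension
        -- itself is at most e^{e²} and each term is at most 1.
        rcases le_total 2 L with h2 | h2
        · refine le_trans ?_ (le_add_of_nonneg_left (Real.exp_pos _).le)
          calc _ ≤ ∑ k : Fin d, ((k : ℝ) + 1) ^ (-2 : ℝ) := by
                refine Finset.sum_le_sum fun k _ => (hyL k).trans ?_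
                exact Real.rpow_le_rpow_of_exponent_le
                  (by linarith [(k : ℕ).cast_nonneg (α := ℝ)]) (by linarith)
            _ = ∑ k ∈ Finset.range d, ((k : ℝ) + 1) ^ (-2 : ℝ) :=
                Fin.sum_univ_eq_sum_range (fun k : ℕ => ((k : ℝ) + 1) ^ (-2 : ℝ)) d
            _ ≤ _ := hsummable.sum_le_tsum _ fun k _ => by positivity
        · refine le_trans ?_ (le_add_of_nonneg_right hT)
          have hd0 : (1 : ℝ) < d := by exact_mod_cast (by omega : 1 < d)
          calc _ ≤ ∑ k : Fin d, (1 : ℝ) :=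
                Finset.sum_le_sum fun k _ => (hyL k).trans (hone k)
            _ = d := by simp
            _ ≤ _ := by
                rw [← Real.log_le_iff_le_exp (by linarith),
                  ← Real.log_le_iff_le_exp (Real.log_pos hd0)]
                exact h2

theorem one_le_constBound {r : ℝ} (hr : 1 < r) : 1 ≤ constBound r := by
  have hy₀1 : Real.exp (-(Real.log (Real.log 3) / r)) < 1 :=
    Real.exp_lt_one_iff.mpr (neg_neg_of_pos (div_pos log_log_three_pos (by linarith)))
  have hT : 0 ≤ ∑' k : ℕ, ((k : ℝ) + 1) ^ (-2 : ℝ) := tsum_nonneg fun k => by positivity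
  have : 0 < 1 - Real.exp (-(Real.log (Real.log 3) / r)) := by linarith
  exact Real.one_le_exp (by positivity)

end WTD
end

/-! ### Assembly with s = (log log d)/r. -/

theorem mainTheorem5 (r : ℝ) (hr : 1 < r) :
    ∃ C : ℝ, 0 < C ∧
      ∀ (c : ℝ), 1 < c →
      ∀ (τ : ℕ → ℝ), (∀ k, 0 < τ k) → Monotone τ →
        (∀ k : ℕ, c * ((k : ℝ) + 1) ^ r ≤ τ k) →
      ∀ (d : ℕ), 2 < d → ∀ (q : ℕ),
        ((WTD.indexSet (WTD.weight τ d) q).Finite ∧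
          ((WTD.indexSet (WTD.weight τ d) q).ncard : ℝ)
            ≤ C * Real.log (d : ℝ) ^ ((q : ℝ) / r)) ∧
        ∀ (v : C(WTD.Cube d, ℝ)) (vt : (Fin d → ℂ) → ℂ),
          WTD.IsAnalyticExtension (fun k : Fin d => τ k) v vt →
        ∀ (ξ : WTD.indexSet (WTD.weight τ d) q → WTD.Cube d) (hξ : WTD.Unisolvent ξ),
          ‖v - (WTD.interp hξ v : C(WTD.Cube d, ℝ))‖
            ≤ (1 + WTD.lebesgueConst hξ) * C * 2 ^ (d + 1)
              * Real.exp (-(q : ℝ) * (1 - 1 / r * Real.log (Real.log (d : ℝ))))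
              * WTD.regionNorm (fun k : Fin d => τ k) vt := by
  have hC := WTD.one_le_constBound hr
  refine ⟨WTD.constBound r, by linarith, fun c hc τ hτ _ hτc d hd q => ?_⟩
  have hr0 : 0 < r := by linarith
  have hL0 : 0 < Real.log (Real.log d) :=
    WTD.log_log_three_pos.trans_le (WTD.log_log_three_le hd)
  have hd1 : (1 : ℝ) < d := by exact_mod_cast (by omega : 1 < d)
  have hlog : 0 < Real.log d := Real.log_pos hd1
  have hω : ∀ k, 0 < WTD.weight τ d k := WTD.weight_pos hτ d
  have hK := WTD.weightProd_le_constBound hr c hc hτc hd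
  set s := 1 / r * Real.log (Real.log d) with hs
  have hs0 : 0 < s := by positivity
  refine ⟨⟨WTD.indexSet_finite hω q, ?_⟩, fun v vt h ξ hξ => ?_⟩
  · refine (WTD.ncard_indexSet_le hω q hs0).trans ?_
    rw [Real.rpow_def_of_pos hlog, show Real.log (Real.log d) * ((q : ℝ) / r) = q * s by
      rw [hs]; ring]
    gcongr
  · have hM := WTD.regionNorm_nonneg (fun k : Fin d => τ k) vt
    have hL : 0 ≤ WTD.lebesgueConst hξ := norm_nonneg _
    obtain ⟨p, hp, hvp⟩ : ∃ p ∈ WTD.polySpace (WTD.weight τ d) q,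
        ‖v - p‖ ≤ WTD.constBound r * Real.exp (-(q : ℝ) * (1 - s))
          * WTD.regionNorm (fun k : Fin d => τ k) vt := by
      -- For s ≥ 1 the claimed exponential is at least 1, so p = 0 is good enough.
      rcases le_total s 1 with hs1 | hs1
      · obtain ⟨p, hp, hvp⟩ := WTD.exists_polySpace_approx hτ h q hs0 hs1
        refine ⟨p, hp, hvp.trans ?_⟩
        rw [mul_comm (WTD.constBound r)]
        gcongr
      · refine ⟨0, Submodule.zero_mem _, ?_⟩
        rw [sub_zero]
        refine (WTD.norm_le_regionNorm (fun k => hτ k) h).trans (le_mul_of_one_le_left hM ?_)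
        refine one_le_mul_of_one_le_of_one_le hC (Real.one_le_exp ?_)
        nlinarith [(Nat.cast_nonneg q : (0 : ℝ) ≤ q)]
    -- The factor 2^{d+1} is pure slack here: the signed sum over ℤ^d already fits into the
    -- constant.
    have h2 : (1 : ℝ) ≤ 2 ^ (d + 1) := one_le_pow₀ one_le_two
    calc _ ≤ (1 + WTD.lebesgueConst hξ) * ‖v - p‖ := WTD.norm_sub_interp_le hω hξ v hp
      _ ≤ (1 + WTD.lebesgueConst hξ) * (WTD.constBound r * Real.exp (-(q : ℝ) * (1 - s))
          * WTD.regionNorm (fun k : Fin d => τ k) vt) := by gcongr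
      _ ≤ (1 + WTD.lebesgueConst hξ) * (WTD.constBound r * Real.exp (-(q : ℝ) * (1 - s))
          * WTD.regionNorm (fun k : Fin d => τ k) vt) * 2 ^ (d + 1) :=
          le_mul_of_one_le_right (by positivity) h2
      _ = _ := by ring
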